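/- Let $b_1,\dots,b_5,c_1,\dots,c_5\in\mathbb C$ with $b_jc_j=1$ for all $j$, and let $A$ be the reciprocal $6\times 6$ matrix with these data: the tridiagonal matrix with zero main diagonal, superdiagonal $b_1,\dots,b_5$ and subdiagonal $c_1,\dots,c_5$. Put $A_j=\tfrac12(|b_j|^2+|c_j|^2)$ $(\ge 1)$. The Kippenhahn curve $C(A)$ is the curve (of class $6$) whose tangent lines are the lines $\{e^{-i\theta}(\mu+it):t\in\mathbb R\}$, where $\theta\in\mathbb R$ and $\mu$ is an eigenvalue of $\operatorname{Re}(e^{i\theta}A)=\tfrac12\left(e^{i\theta}A+e^{-i\theta}A^*\right)$. An ellipse, with any center, half-axes and orientation, is a component of $C(A)$ if all its tangent lines are tangent lines of $C(A)$. An ellipse may degenerate into the doubleton $\{p,q\}$, $p\ne q$, of its foci, whose tangent lines are all lines passing through $p$ or through $q$. An elliptical component is an ellipse, non-degenerate or degenerate in this sense, that is a component of $C(A)$. Let $$R_j(x)=r_{j2}x^2+r_{j1}x+r_{j0}\qquad(j=1,2),$$ where \begin{align*} r_{12}={}&-8(A_1^2+A_2A_3+A_3A_4+A_5^2)-28(A_1A_2-A_1A_4-A_2A_5+A_4A_5)\\&+4(A_1A_3+A_3A_5+A_3^2)-12(A_2^2+A_4^2-A_1A_5)+32A_2A_4,\\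 r_{11}={}&12(A_2^2+A_4^2)+18(A_1A_2-A_2A_4+A_4A_5)-24(A_1A_4+A_2A_5)+6(A_1A_3-A_3^2+A_3A_5),\\ r_{10}={}&4(A_1^2-A_2^2-A_4^2+A_5^2+A_2A_3+A_3A_4)-(A_1A_2+A_2A_4+A_4A_5)\\&-7(A_1A_3+A_3A_5)+6(A_1A_4-A_1A_5+A_2A_5)+3A_3^2,\\ r_{22}={}&-12(A_1^3+A_5^3)-48(A_1^2A_2+A_4A_5^2)-60(A_1A_2^2+A_4^2A_5)-16(A_2^3+A_4^3)\\&+44(A_1A_3^2-A_1A_2A_3+A_1A_2A_5+A_3^2A_5+A_1A_4A_5-A_3A_4A_5)\\&-36(A_2^2A_3-A_2^2A_4-A_2A_4^2+A_3A_4^2)-24(A_2A_3^2+A_3^2A_4-A_1A_4^2-A_2^2A_5)\\&+8(A_1^2A_4+A_2A_5^2)+20(A_1A_2A_4+A_1^2A_5+A_2A_4A_5+A_1A_5^2)\\&+68(A_1A_3A_4+A_2A_3A_5)-4A_3^3+40A_2A_3A_4-84A_1A_3A_5,\\ r_{21}={}&14(A_1^3+A_5^3-A_1A_4^2-A_2^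2A_5)+56(A_1A_2^2+A_4^2A_5)+16(A_2^3+A_4^3)\\&-12(A_1^2A_3+A_3A_5^2)+30(A_2^2A_3+A_3A_4^2)-50(A_1A_3^2+A_3^2A_5)+20(A_2A_3^2+A_3^2A_4)\\&-22(A_1^2A_4+A_2^2A_4+A_2A_4^2+A_2A_5^2)-28(A_1A_2A_4+A_1^2A_5+A_2A_4A_5+A_1A_5^2)\\&-66(A_1A_3A_4+A_2A_3A_5)-44(A_1A_2A_5+A_1A_4A_5)+48(A_1^2A_2+A_4A_5^2)\\&+46(A_1A_2A_3+A_3A_4A_5)+6A_3^3+158A_1A_3A_5-52A_2A_3A_4,\\ r_{20}={}&-2(A_1^3+A_2^3+A_3^3+A_4^3+A_5^3+A_2A_3^2+A_3^2A_4)\\&-4(A_1^2A_2+A_1A_2^2+A_1A_4^2+A_2^2A_5+A_4^2A_5+A_4A_5^2)\\&+6(A_1^2A_3+A_1A_2A_4-A_2^2A_4-A_2A_4^2+A_1A_2A_5+A_1A_4A_5+A_2A_4A_5+A_3A_5^2)\\&-10(A_1A_2A_3+A_3A_4A_5-A_1^2A_4-A_2A_5^2)-(A_2^2A_3+A_3A_4^2)+12(A_1A_3^2+A_3^2A_5)\\&+11(A_1A_3A_4+A_2A_3A_5)+8(A_1^2A_5+A_1A_5^2)+19A_2A_3A_4-65A_1A_3A_5.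 \end{align*} Then the following hold. (i) $C(A)$ has an elliptical component if and only if there is a root $x\in\mathbb R$ of the cubic equation $$8x^3-20x^2+12x-1=0$$ such that $R_1(x)=R_2(x)=0$. (ii) If $A_1,A_3,A_5>1$, then the condition in (i) is also necessary and sufficient for $C(A)$ to have a non-degenerate ellipse as a component. (iii) For every real root $x$ of the cubic equation, $R_1(x)=128\operatorname{Res}_z(Q_1,Q_2)$ and $R_2(x)=512\operatorname{Res}_z(Q_1,Q_3)$, where, with $S=A_1+A_2+A_3+A_4+A_5$, $L=3A_1+2A_2+2A_3+2A_4+3A_5$, $T=A_1A_3+A_1A_4+A_1A_5+A_2A_4+A_2A_5+A_3A_5$ and $U=A_1A_3+A_1A_5+A_3A_5$, \begin{align*} Q_1&=\left(3x^2-5x+\tfrac32\right)z-\tfrac12Sx^2+\tfrac14Lx-\tfrac18(A_1+A_3+A_5),\\ Q_2&=\left(3x-\tfrac52\right)z^2+\left(-Sx+\tfrac14L\right)z+\tfrac14Tx-\tfrac18U,\\ Q_3&=z^3-\tfrac12Sz^2+\tfrac14Tz-\tfrac18A_1A_3A_5, \end{align*} and $\operatorname{Res}_z$ is the resultant (determinant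 of the Sylvester matrix) in $z$ with formal degrees $(1,2)$ and $(1,3)$ respectively. -/

import Mathlib

open Complex

noncomputable section

namespace Kippenhahn

/-- The tridiagonal matrix with constant main diagonal `a`, superdiagonal `b` and
subdiagonal `c`. -/
def tridiag {m : ℕ} (a : ℂ) (b c : Fin m → ℂ) : Matrix (Fin (m + 1)) (Fin (m + 1)) ℂ :=
  Matrix.of fun i j =>
    if i = j then a
    else if h : j.val = i.val + 1 then b ⟨i.val, by omega⟩
    else if h : i.val = j.val + 1 then c ⟨j.val, by omega⟩
    else 0

/-- The hermitian part `(A + A*) / 2` of a square matrix. -/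
def rePart {n : ℕ} (A : Matrix (Fin n) (Fin n) ℂ) : Matrix (Fin n) (Fin n) ℂ :=
  (1 / 2 : ℂ) • (A + A.conjTranspose)

/-- The real line in the plane `ℂ` through `p` with direction `d` (a line when `d ≠ 0`). -/
def realLine (p d : ℂ) : Set ℂ := {w | ∃ s : ℝ, w = p + (s : ℂ) * d}

/-- The Kippenhahn curve `C(A)`, given, as a curve of class `n`, by the family of its tangent
lines: these are the lines `{e^{-iθ}(μ + it) : t ∈ ℝ}`, where `θ` is real and `μ` is an
eigenvalue of the hermitian matrix `Re(e^{iθ} A)`. -/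
def kippenhahnTangents {n : ℕ} (A : Matrix (Fin n) (Fin n) ℂ) : Set (Set ℂ) :=
  {L | ∃ θ μ : ℝ, (μ : ℂ) ∈ spectrum ℂ (rePart (exp ((θ : ℂ) * I) • A)) ∧
    L = realLine (exp (-((θ : ℂ) * I)) * (μ : ℂ)) (exp (-((θ : ℂ) * I)) * I)}

/-- The point with parameter `t` of the ellipse with center `m`, half-axes `a` and `b`, and
first axis in the direction of the unit vector `u`. -/
def ellipsePoint (m u : ℂ) (a b t : ℝ) : ℂ :=
  m + u * ((a * Real.cos t : ℝ) + (b * Real.sin t : ℝ) * I)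

/-- The derivative of `ellipsePoint` in `t`: a direction vector of the tangent line. -/
def ellipseVelocity (u : ℂ) (a b t : ℝ) : ℂ :=
  u * ((-(a * Real.sin t) : ℝ) + (b * Real.cos t : ℝ) * I)

/-- The tangent lines of the ellipse with center `m`, half-axes `a > 0` and `b > 0`, and first
axis in the direction of `u`. -/
def ellipseTangents (m u : ℂ) (a b : ℝ) : Set (Set ℂ) :=
  {L | ∃ t : ℝ, L = realLine (ellipsePoint m u a b t) (ellipseVelocity u a b t)}

/-- The tangent lines of the doubleton `{p, q}` regarded as a degenerate ellipse with foci
`p` and `q` (minor axis of length zero): all lines passing through `p` or through `q`. -/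
def doubletonTangents (p q : ℂ) : Set (Set ℂ) :=
  {L | ∃ d : ℂ, d ≠ 0 ∧ (L = realLine p d ∨ L = realLine q d)}

/-- The curve `C(A)` has a non-degenerate ellipse (arbitrary center, axes and orientation)
among its components. -/
def HasEllipseComponent {n : ℕ} (A : Matrix (Fin n) (Fin n) ℂ) : Prop :=
  ∃ (m u : ℂ) (a b : ℝ), ‖u‖ = 1 ∧ 0 < b ∧ b ≤ a ∧
    ellipseTangents m u a b ⊆ kippenhahnTangents A

/-- The curve `C(A)` has among its components an ellipse that degenerates into the doubleton of
its foci. -/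
def HasDoubletonComponent {n : ℕ} (A : Matrix (Fin n) (Fin n) ℂ) : Prop :=
  ∃ p q : ℂ, p ≠ q ∧ doubletonTangents p q ⊆ kippenhahnTangents A

/-- The curve `C(A)` has an elliptical component, possibly degenerating into the doubleton of
its foci. -/
def HasEllipticalComponent {n : ℕ} (A : Matrix (Fin n) (Fin n) ℂ) : Prop :=
  HasEllipseComponent A ∨ HasDoubletonComponent A

/-- The numbers `A_j = (|b_j|² + |c_j|²) / 2`. -/
def offDiagParam {m : ℕ} (b c : Fin m → ℂ) (j : Fin m) : ℝ := (‖b j‖ ^ 2 + ‖c j‖ ^ 2) / 2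

/-! The polynomials in `z` which arise as the coefficients of `τ²`, `τ`, `1` when `xτ + z` is
substituted for `λ²` in the NR generating polynomial of a reciprocal 6-by-6 matrix. -/

/-- `Q₁ = q₁₁ z + q₁₀` -/
def Q1 (A₁ A₂ A₃ A₄ A₅ x : ℝ) : Polynomial ℝ :=
  .C (3 * x ^ 2 - 5 * x + 3 / 2) * .X
  + .C (-(1 / 2) * (A₁ + A₂ + A₃ + A₄ + A₅) * x ^ 2
      + 1 / 4 * (3 * A₁ + 2 * A₂ + 2 * A₃ + 2 * A₄ + 3 * A₅) * x
      - 1 / 8 * (A₁ + A₃ + A₅))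

/-- `Q₂ = q₂₂ z² + q₂₁ z + q₂₀` -/
def Q2 (A₁ A₂ A₃ A₄ A₅ x : ℝ) : Polynomial ℝ :=
  .C (3 * x - 5 / 2) * .X ^ 2
  + .C (-(A₁ + A₂ + A₃ + A₄ + A₅) * x
      + 1 / 4 * (3 * A₁ + 2 * A₂ + 2 * A₃ + 2 * A₄ + 3 * A₅)) * .X
  + .C (1 / 4 * (A₁ * A₃ + A₅ * A₃ + A₁ * A₄ + A₂ * A₄ + A₁ * A₅ + A₂ * A₅) * x
      - 1 / 8 * (A₁ * A₃ + A₅ * A₃ + A₁ * A₅))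

/-- `Q₃ = z³ + q₃₂ z² + q₃₁ z + q₃₀` -/
def Q3 (A₁ A₂ A₃ A₄ A₅ : ℝ) : Polynomial ℝ :=
  .X ^ 3 + .C (-(1 / 2) * (A₁ + A₂ + A₃ + A₄ + A₅)) * .X ^ 2
  + .C (1 / 4 * (A₁ * A₃ + A₅ * A₃ + A₁ * A₄ + A₂ * A₄ + A₁ * A₅ + A₂ * A₅)) * .X
  + .C (-(1 / 8) * (A₁ * A₃ * A₅))

def r12 (A₁ A₂ A₃ A₄ A₅ : ℝ) : ℝ :=
  -8 * (A₁ ^ 2 + A₂ * A₃ + A₃ * A₄ + A₅ ^ 2)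
  - 28 * (A₁ * A₂ - A₁ * A₄ - A₂ * A₅ + A₄ * A₅)
  + 4 * (A₁ * A₃ + A₃ * A₅ + A₃ ^ 2)
  - 12 * (A₂ ^ 2 + A₄ ^ 2 - A₁ * A₅) + 32 * A₂ * A₄

def r11 (A₁ A₂ A₃ A₄ A₅ : ℝ) : ℝ :=
  12 * (A₂ ^ 2 + A₄ ^ 2) + 18 * (A₁ * A₂ - A₂ * A₄ + A₄ * A₅)
  - 24 * (A₁ * A₄ + A₂ * A₅) + 6 * (A₁ * A₃ - A₃ ^ 2 + A₃ * A₅)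

def r10 (A₁ A₂ A₃ A₄ A₅ : ℝ) : ℝ :=
  4 * (A₁ ^ 2 - A₂ ^ 2 - A₄ ^ 2 + A₅ ^ 2 + A₂ * A₃ + A₃ * A₄)
  - (A₁ * A₂ + A₂ * A₄ + A₄ * A₅) - 7 * (A₁ * A₃ + A₃ * A₅)
  + 6 * (A₁ * A₄ - A₁ * A₅ + A₂ * A₅) + 3 * A₃ ^ 2

def r22 (A₁ A₂ A₃ A₄ A₅ : ℝ) : ℝ :=
  -12 * (A₁ ^ 3 + A₅ ^ 3) - 48 * (A₁ ^ 2 * A₂ + A₄ * A₅ ^ 2)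
  - 60 * (A₁ * A₂ ^ 2 + A₄ ^ 2 * A₅) - 16 * (A₂ ^ 3 + A₄ ^ 3)
  + 44 * (A₁ * A₃ ^ 2 - A₁ * A₂ * A₃ + A₁ * A₂ * A₅ + A₃ ^ 2 * A₅ + A₁ * A₄ * A₅
      - A₃ * A₄ * A₅)
  - 36 * (A₂ ^ 2 * A₃ - A₂ ^ 2 * A₄ - A₂ * A₄ ^ 2 + A₃ * A₄ ^ 2)
  - 24 * (A₂ * A₃ ^ 2 + A₃ ^ 2 * A₄ - A₁ * A₄ ^ 2 - A₂ ^ 2 * A₅)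
  + 8 * (A₁ ^ 2 * A₄ + A₂ * A₅ ^ 2)
  + 20 * (A₁ * A₂ * A₄ + A₁ ^ 2 * A₅ + A₂ * A₄ * A₅ + A₁ * A₅ ^ 2)
  + 68 * (A₁ * A₃ * A₄ + A₂ * A₃ * A₅) - 4 * A₃ ^ 3 + 40 * A₂ * A₃ * A₄
  - 84 * (A₁ * A₃ * A₅)

def r21 (A₁ A₂ A₃ A₄ A₅ : ℝ) : ℝ :=
  14 * (A₁ ^ 3 + A₅ ^ 3 - A₁ * A₄ ^ 2 - A₂ ^ 2 * A₅)
  + 56 * (A₁ * A₂ ^ 2 + A₄ ^ 2 * A₅) + 16 * (A₂ ^ 3 + A₄ ^ 3)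
  - 12 * (A₁ ^ 2 * A₃ + A₃ * A₅ ^ 2) + 30 * (A₂ ^ 2 * A₃ + A₃ * A₄ ^ 2)
  - 50 * (A₁ * A₃ ^ 2 + A₃ ^ 2 * A₅) + 20 * (A₂ * A₃ ^ 2 + A₃ ^ 2 * A₄)
  - 22 * (A₁ ^ 2 * A₄ + A₂ ^ 2 * A₄ + A₂ * A₄ ^ 2 + A₂ * A₅ ^ 2)
  - 28 * (A₁ * A₂ * A₄ + A₁ ^ 2 * A₅ + A₂ * A₄ * A₅ + A₁ * A₅ ^ 2)
  - 66 * (A₁ * A₃ * A₄ + A₂ * A₃ * A₅) - 44 * (A₁ * A₂ * A₅ + A₁ * A₄ * A₅)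
  + 48 * (A₁ ^ 2 * A₂ + A₄ * A₅ ^ 2) + 46 * (A₁ * A₂ * A₃ + A₃ * A₄ * A₅)
  + 6 * A₃ ^ 3 + 158 * A₁ * A₃ * A₅ - 52 * A₂ * A₃ * A₄

def r20 (A₁ A₂ A₃ A₄ A₅ : ℝ) : ℝ :=
  -2 * (A₁ ^ 3 + A₂ ^ 3 + A₃ ^ 3 + A₄ ^ 3 + A₅ ^ 3 + A₂ * A₃ ^ 2 + A₃ ^ 2 * A₄)
  - 4 * (A₁ ^ 2 * A₂ + A₁ * A₂ ^ 2 + A₁ * A₄ ^ 2 + A₂ ^ 2 * A₅ + A₄ ^ 2 * A₅ + A₄ * A₅ ^ 2)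
  + 6 * (A₁ ^ 2 * A₃ + A₁ * A₂ * A₄ - A₂ ^ 2 * A₄ - A₂ * A₄ ^ 2 + A₁ * A₂ * A₅
      + A₁ * A₄ * A₅ + A₂ * A₄ * A₅ + A₃ * A₅ ^ 2)
  - 10 * (A₁ * A₂ * A₃ + A₃ * A₄ * A₅ - A₁ ^ 2 * A₄ - A₂ * A₅ ^ 2)
  - (A₂ ^ 2 * A₃ + A₃ * A₄ ^ 2) + 12 * (A₁ * A₃ ^ 2 + A₃ ^ 2 * A₅)
  + 11 * (A₁ * A₃ * A₄ + A₂ * A₃ * A₅) + 8 * (A₁ ^ 2 * A₅ + A₁ * A₅ ^ 2)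
  + 19 * A₂ * A₃ * A₄ - 65 * A₁ * A₃ * A₅

/-- The quadratic polynomial `R₁(x) = r₁₂ x² + r₁₁ x + r₁₀`. -/
def R1 (A₁ A₂ A₃ A₄ A₅ x : ℝ) : ℝ :=
  r12 A₁ A₂ A₃ A₄ A₅ * x ^ 2 + r11 A₁ A₂ A₃ A₄ A₅ * x + r10 A₁ A₂ A₃ A₄ A₅

/-- The quadratic polynomial `R₂(x) = r₂₂ x² + r₂₁ x + r₂₀`. -/
def R2 (A₁ A₂ A₃ A₄ A₅ x : ℝ) : ℝ :=
  r22 A₁ A₂ A₃ A₄ A₅ * x ^ 2 + r21 A₁ A₂ A₃ A₄ A₅ * x + r20 A₁ A₂ A₃ A₄ A₅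

end Kippenhahn

end

/-!
For a unit number `n = e^{iθ}`, the hermitian matrix `Re(n A)` is tridiagonal with zero diagonal, and
since `b_j c_j = 1` the products of its opposite off-diagonal entries are `(A_j + τ) / 2` with
`τ = cos 2θ`. Its characteristic polynomial is therefore a polynomial `P(ζ, τ)` in `ζ = λ²` and `τ`,
and a line with unit normal `conj n` through `p` is a tangent of `C(A)` iff `P(Re(n p)², Re(n²)) = 0`
(`realLine_mem_kippenhahnTangents_iff`). Substituting `ζ = xτ + z` gives
`P = (8x³ - 20x² + 12x - 1)/8 τ³ + Q₁(z) τ² + Q₂(z) τ + Q₃(z)` (`ngPoly_linear`).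

An elliptical component produces a quadratic form in `(cos θ, sin θ)`, that is, an expression
`x cos 2θ + y sin 2θ + z`, which is a root `ζ` of `P` for every `θ`. For a centered ellipse this is
the squared support function, for a doubleton it comes from one of the two foci, and for an ellipse
with another center the support values `l ± g` provide two roots `(l ± g)²` of the cubic `P(·, τ)`
and the form is the third one, by Vieta. As the cubic has only real roots, the highest Fourier
coefficient forces `y = 0` (`ngPoly_form_root`), so that `x` is a root of the cubic and `z` is a
common root of `Q₁`, `Q₂`, `Q₃`. The cubic has simple roots, which means that `Q₁` has degree one at
such an `x`; a common root then exists iff the two resultants, and so `R₁(x)` and `R₂(x)`, vanish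
(`eval_eq_zero_iff_R`).

Conversely, let `xτ + z` be a root of `P(·, τ)` for all `τ`. Roots of the cubic are positive, and as
`A_j ≥ 1` no root `ζ` is negative at `τ = -1`, whence `z ≥ x > 0`. If `z > x`, the ellipse with
half-axes `√(z ± x)` is a component of `C(A)`, and if `z = x`, the doubleton `±√(2x)` is one. The
latter case requires `P(0, -1) = -(A₁ - 1)(A₃ - 1)(A₅ - 1)/8` to vanish.
-/

noncomputable section

namespace Kippenhahn

open ComplexConjugate

/-! ### The NR generating polynomial -/

/-- The characteristic polynomial of `Re(e^{iθ} A)` for a reciprocal `6`-by-`6` matrix `A`, with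
`ζ = λ²` and `τ = cos 2θ`: the NR generating polynomial. It is monic of degree `3` in `ζ`, and as a
tridiagonal determinant depends only on the products `(A_j + τ) / 2` of opposite off-diagonal
entries. -/
def ngPoly (A₁ A₂ A₃ A₄ A₅ ζ τ : ℝ) : ℝ :=
  ζ ^ 3 - 1 / 2 * (A₁ + A₂ + A₃ + A₄ + A₅ + 5 * τ) * ζ ^ 2
  + 1 / 4 * ((A₁ + τ) * (A₃ + τ) + (A₁ + τ) * (A₄ + τ) + (A₁ + τ) * (A₅ + τ)
      + (A₂ + τ) * (A₄ + τ) + (A₂ + τ) * (A₅ + τ) + (A₃ + τ) * (A₅ + τ)) * ζ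
  - 1 / 8 * ((A₁ + τ) * (A₃ + τ) * (A₅ + τ))

theorem ngPoly_linear (A₁ A₂ A₃ A₄ A₅ x z τ : ℝ) :
    ngPoly A₁ A₂ A₃ A₄ A₅ (x * τ + z) τ =
      (8 * x ^ 3 - 20 * x ^ 2 + 12 * x - 1) / 8 * τ ^ 3
      + (Q1 A₁ A₂ A₃ A₄ A₅ x).eval z * τ ^ 2 + (Q2 A₁ A₂ A₃ A₄ A₅ x).eval z * τ
      + (Q3 A₁ A₂ A₃ A₄ A₅).eval z := by
  simp only [ngPoly, Q1, Q2, Q3, Polynomial.eval_add, Polynomial.eval_mul, Polynomial.eval_pow,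
    Polynomial.eval_C, Polynomial.eval_X]
  ring

/-- Two distinct roots of the cubic determine the third one, because the three sum to
`(A₁ + ⋯ + A₅ + 5τ) / 2`. -/
theorem eq_zero_of_vieta {A₁ A₂ A₃ A₄ A₅ τ r₁ r₂ : ℝ} (h₁ : ngPoly A₁ A₂ A₃ A₄ A₅ r₁ τ = 0)
    (h₂ : ngPoly A₁ A₂ A₃ A₄ A₅ r₂ τ = 0) (hne : r₁ ≠ r₂) :
    ngPoly A₁ A₂ A₃ A₄ A₅ ((A₁ + A₂ + A₃ + A₄ + A₅ + 5 * τ) / 2 - r₁ - r₂) τ = 0 := by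
  have h : r₁ - r₂ ≠ 0 := sub_ne_zero.2 hne
  apply mul_left_cancel₀ h
  unfold ngPoly at *
  generalize 1 / 4 * ((A₁ + τ) * (A₃ + τ) + (A₁ + τ) * (A₄ + τ) + (A₁ + τ) * (A₅ + τ)
      + (A₂ + τ) * (A₄ + τ) + (A₂ + τ) * (A₅ + τ) + (A₃ + τ) * (A₅ + τ)) = e at *
  generalize 1 / 8 * ((A₁ + τ) * (A₃ + τ) * (A₅ + τ)) = k at *
  have hs : ∀ s : ℝ, s / 2 = 1 / 2 * s := fun s => by ring
  rw [hs]
  generalize 1 / 2 * (A₁ + A₂ + A₃ + A₄ + A₅ + 5 * τ) = s at *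
  linear_combination (s - r₁ - r₂ - r₂) * h₁ - (s - r₁ - r₂ - r₁) * h₂

theorem ngPoly_neg {A₁ A₂ A₃ A₄ A₅ ζ τ : ℝ} (h₁ : 0 ≤ A₁ + τ) (h₂ : 0 ≤ A₂ + τ)
    (h₃ : 0 ≤ A₃ + τ) (h₄ : 0 ≤ A₄ + τ) (h₅ : 0 ≤ A₅ + τ) (hζ : ζ < 0) :
    ngPoly A₁ A₂ A₃ A₄ A₅ ζ τ < 0 := by
  obtain ⟨n, rfl⟩ : ∃ n, ζ = -n := ⟨-ζ, by ring⟩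
  have hn : 0 < n := by linarith
  have : 0 < n ^ 3 + 1 / 2 * ((A₁ + τ) + (A₂ + τ) + (A₃ + τ) + (A₄ + τ) + (A₅ + τ)) * n ^ 2
    + 1 / 4 * ((A₁ + τ) * (A₃ + τ) + (A₁ + τ) * (A₄ + τ) + (A₁ + τ) * (A₅ + τ)
      + (A₂ + τ) * (A₄ + τ) + (A₂ + τ) * (A₅ + τ) + (A₃ + τ) * (A₅ + τ)) * n
    + 1 / 8 * ((A₁ + τ) * (A₃ + τ) * (A₅ + τ)) := by positivity
  unfold ngPoly
  linarith

/-! ### The cubic equation -/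

theorem cubic_root_pos {x : ℝ} (hx : 8 * x ^ 3 - 20 * x ^ 2 + 12 * x - 1 = 0) : 0 < x := by
  by_contra! h
  nlinarith [mul_nonneg (neg_nonneg.2 h) (sq_nonneg x), sq_nonneg x]

/-- The number `3x² - 5x + 3/2` is an eighth of the derivative of the cubic at `x`. -/
theorem cubic_root_simple {x : ℝ} (hx : 8 * x ^ 3 - 20 * x ^ 2 + 12 * x - 1 = 0) :
    3 * x ^ 2 - 5 * x + 3 / 2 ≠ 0 := by
  intro h
  have hx' : x = 3 / 4 := by
    linear_combination (9 / 28 : ℝ) * (-hx + (8 / 3 * x - 20 / 9) * h)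
  subst hx'
  norm_num at h

/-- The two hypotheses are the imaginary part (divided by `y`) and the real part of the equation
`p(x + iy) = 0`, where `8p` is the cubic; all roots of the cubic are real. -/
theorem cubic_no_nonreal_root {x y : ℝ} (hy : y ≠ 0)
    (him : 3 * x ^ 2 - 5 * x + 3 / 2 - y ^ 2 = 0)
    (hre : (8 * x ^ 3 - 20 * x ^ 2 + 12 * x - 1) / 8 - y ^ 2 * (3 * x - 5 / 2) = 0) : False := by
  obtain ⟨v, rfl⟩ : ∃ v, x = v + 5 / 6 := ⟨x - 5 / 6, by ring⟩
  have hy2 : 0 < y ^ 2 := by positivity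
  have he : y ^ 2 = 3 * v ^ 2 - 7 / 12 := by linear_combination -him
  have hv : v * (8 / 3 * y ^ 2 + 7 / 18) = -(7 / 216) := by
    rw [he] at hre ⊢
    linear_combination -hre
  have hv0 : v < 0 := by nlinarith
  have hv1 : -(1 / 12) < v := by nlinarith
  nlinarith

/-! ### Roots of the generating polynomial that are linear in `τ` -/

/-- If `ζ = x cos 2θ + y sin 2θ + z` is a root of the NR generating polynomial for every `θ`, then
the term in `sin 2θ` vanishes: the highest Fourier coefficient of `P(ζ(θ), cos 2θ)` is a multiple
of `p(x - iy)`, where `8p` is the cubic, whose roots are real. -/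
theorem ngPoly_form_root {A₁ A₂ A₃ A₄ A₅ x y z : ℝ}
    (h : ∀ c s : ℝ, c ^ 2 + s ^ 2 = 1 → ngPoly A₁ A₂ A₃ A₄ A₅ (x * c + y * s + z) c = 0) :
    8 * x ^ 3 - 20 * x ^ 2 + 12 * x - 1 = 0 ∧ (Q1 A₁ A₂ A₃ A₄ A₅ x).eval z = 0 ∧
      (Q2 A₁ A₂ A₃ A₄ A₅ x).eval z = 0 ∧ (Q3 A₁ A₂ A₃ A₄ A₅).eval z = 0 := by
  -- Eight rational points of the circle suffice for extracting the coefficients needed.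
  have a1 := h 1 0 (by norm_num)
  have a2 := h (-1) 0 (by norm_num)
  have a3 := h 0 1 (by norm_num)
  have a4 := h 0 (-1) (by norm_num)
  have a5 := h (3 / 5) (4 / 5) (by norm_num)
  have a6 := h (3 / 5) (-(4 / 5)) (by norm_num)
  have a7 := h (-(3 / 5)) (4 / 5) (by norm_num)
  have a8 := h (-(3 / 5)) (-(4 / 5)) (by norm_num)
  have hy : y = 0 := by
    by_contra hy
    refine cubic_no_nonreal_root (x := x) hy ?_ ?_
    -- The coefficient of `c²` in the part of `P` that is odd in `s`, divided by `s`.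
    · apply mul_left_cancel₀ hy
      unfold ngPoly at *
      linear_combination (25 / 18 : ℝ) * (1 / (2 * (4 / 5)) * (a5 - a6 + a7 - a8) - (a3 - a4))
    -- The coefficient of `c³` in the part of `P` that is even in `s`.
    · unfold ngPoly at *
      linear_combination (25 / 16 : ℝ) * ((a1 - a2) / 2 - (5 / 3) * (a5 + a6 - a7 - a8) / 4)
  subst hy
  simp only [zero_mul, add_zero, ngPoly_linear] at a1 a2 a3 a5
  refine ⟨?_, ?_, ?_, ?_⟩ <;> linarith

/-! ### Resultants -/

theorem resultant_one_two (a b c₂ c₁ c₀ : ℝ) :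
    Polynomial.resultant (.C a * .X + .C b) (.C c₂ * .X ^ 2 + .C c₁ * .X + .C c₀) 1 2
      = c₂ * b ^ 2 - c₁ * (a * b) + c₀ * a ^ 2 := by
  simp [Polynomial.resultant, Polynomial.sylvester, Matrix.det_succ_row_zero, Fin.sum_univ_succ,
    Fin.addCases, Polynomial.coeff_X, Polynomial.coeff_C, Polynomial.coeff_X_pow, Fin.succAbove,
    Matrix.submatrix]
  ring

theorem resultant_one_three (a b c₂ c₁ c₀ : ℝ) :
    Polynomial.resultant (.C a * .X + .C b) (.X ^ 3 + .C c₂ * .X ^ 2 + .C c₁ * .X + .C c₀) 1 3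
      = -b ^ 3 + c₂ * (a * b ^ 2) - c₁ * (a ^ 2 * b) + c₀ * a ^ 3 := by
  simp [Polynomial.resultant, Polynomial.sylvester, Matrix.det_succ_row_zero, Fin.sum_univ_succ,
    Fin.addCases, Polynomial.coeff_X, Polynomial.coeff_C, Polynomial.coeff_X_pow, Fin.succAbove,
    Matrix.submatrix]
  ring

theorem R1_eq_resultant (A₁ A₂ A₃ A₄ A₅ : ℝ) {x : ℝ}
    (hx : 8 * x ^ 3 - 20 * x ^ 2 + 12 * x - 1 = 0) :
    R1 A₁ A₂ A₃ A₄ A₅ x =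
      128 * Polynomial.resultant (Q1 A₁ A₂ A₃ A₄ A₅ x) (Q2 A₁ A₂ A₃ A₄ A₅ x) 1 2 := by
  rw [Q1, Q2, resultant_one_two]
  obtain ⟨S, hS⟩ : ∃ S, S = A₁ + A₂ + A₃ + A₄ + A₅ := ⟨_, rfl⟩
  obtain ⟨L, hL⟩ : ∃ L, L = 3 * A₁ + 2 * A₂ + 2 * A₃ + 2 * A₄ + 3 * A₅ := ⟨_, rfl⟩
  obtain ⟨T, hT⟩ : ∃ T, T = A₁ * A₃ + A₅ * A₃ + A₁ * A₄ + A₂ * A₄ + A₁ * A₅ + A₂ * A₅ := ⟨_, rfl⟩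
  obtain ⟨U, hU⟩ : ∃ U, U = A₁ * A₃ + A₅ * A₃ + A₁ * A₅ := ⟨_, rfl⟩
  -- The factor is the quotient of the right-hand side by the cubic, as polynomials in `x`.
  have key := congrArg (((-12 * S ^ 2 + 36 * T) * x ^ 2 + (6 * S * L - 30 * T - 18 * U) * x
    + (-5 * S * L + 6 * S ^ 2 + 7 * T + 15 * U)) * ·) hx
  simp only [mul_zero] at key
  subst hS hL hT hU
  rw [R1, r12, r11, r10]
  linear_combination -key

theorem R2_eq_resultant (A₁ A₂ A₃ A₄ A₅ : ℝ) {x : ℝ}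
    (hx : 8 * x ^ 3 - 20 * x ^ 2 + 12 * x - 1 = 0) :
    R2 A₁ A₂ A₃ A₄ A₅ x =
      512 * Polynomial.resultant (Q1 A₁ A₂ A₃ A₄ A₅ x) (Q3 A₁ A₂ A₃ A₄ A₅) 1 3 := by
  rw [Q1, Q3, resultant_one_three]
  obtain ⟨S, hS⟩ : ∃ S, S = A₁ + A₂ + A₃ + A₄ + A₅ := ⟨_, rfl⟩
  obtain ⟨L, hL⟩ : ∃ L, L = 3 * A₁ + 2 * A₂ + 2 * A₃ + 2 * A₄ + 3 * A₅ := ⟨_, rfl⟩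
  obtain ⟨T, hT⟩ : ∃ T, T = A₁ * A₃ + A₅ * A₃ + A₁ * A₄ + A₂ * A₄ + A₁ * A₅ + A₂ * A₅ := ⟨_, rfl⟩
  obtain ⟨V, hV⟩ : ∃ V, V = A₁ + A₃ + A₅ := ⟨_, rfl⟩
  obtain ⟨W, hW⟩ : ∃ W, W = A₁ * A₃ * A₅ := ⟨_, rfl⟩
  -- The factor is the quotient of the right-hand side by the cubic, as polynomials in `x`.
  have key := congrArg (((-16 * S ^ 3 + 72 * S * T - 216 * W) * x ^ 3
    + (12 * S ^ 2 * L - 36 * L * T - 60 * S * T + 540 * W) * x ^ 2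
    + (-6 * S ^ 2 * V - 10 * S ^ 2 * L + 12 * S ^ 3 + 18 * V * T + 30 * L * T + 14 * S * T
      - 450 * W) * x
    + (-L ^ 3 + 5 * S ^ 2 * V + 10 * S * L ^ 2 - 31 * S ^ 2 * L - 15 * V * T - 7 * L * T
      + 14 * S * T + 118 * W + 28 * S ^ 3)) * ·) hx
  simp only [mul_zero] at key
  subst hS hL hT hV hW
  rw [R2, r22, r21, r20]
  linear_combination -key

/-- Since `Q₁` has degree exactly one, the vanishing of its resultants with `Q₂` and `Q₃` says that
its only root is a root of both. -/
theorem eval_eq_zero_iff_R {A₁ A₂ A₃ A₄ A₅ x : ℝ}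
    (hx : 8 * x ^ 3 - 20 * x ^ 2 + 12 * x - 1 = 0) :
    (∃ z, (Q1 A₁ A₂ A₃ A₄ A₅ x).eval z = 0 ∧ (Q2 A₁ A₂ A₃ A₄ A₅ x).eval z = 0 ∧
      (Q3 A₁ A₂ A₃ A₄ A₅).eval z = 0) ↔ R1 A₁ A₂ A₃ A₄ A₅ x = 0 ∧ R2 A₁ A₂ A₃ A₄ A₅ x = 0 := by
  rw [R1_eq_resultant _ _ _ _ _ hx, R2_eq_resultant _ _ _ _ _ hx, Q1, Q2, Q3, resultant_one_two,
    resultant_one_three]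
  have ha := cubic_root_simple hx
  generalize 3 * x ^ 2 - 5 * x + 3 / 2 = a at *
  generalize -(1 / 2) * (A₁ + A₂ + A₃ + A₄ + A₅) * x ^ 2
      + 1 / 4 * (3 * A₁ + 2 * A₂ + 2 * A₃ + 2 * A₄ + 3 * A₅) * x
      - 1 / 8 * (A₁ + A₃ + A₅) = b
  simp only [Polynomial.eval_add, Polynomial.eval_mul, Polynomial.eval_pow,
    Polynomial.eval_C, Polynomial.eval_X]
  constructor
  · rintro ⟨z, h₁, h₂, h₃⟩
    obtain rfl : b = -(a * z) := by linear_combination h₁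
    constructor
    · linear_combination 128 * a ^ 2 * h₂
    · linear_combination 512 * a ^ 3 * h₃
  · rintro ⟨h₂, h₃⟩
    obtain ⟨z, rfl⟩ : ∃ z, b = -(a * z) := ⟨-b / a, by field_simp⟩
    refine ⟨z, by ring, ?_, ?_⟩
    · apply mul_left_cancel₀ (pow_ne_zero 2 ha)
      linear_combination h₂ / 128
    · apply mul_left_cancel₀ (pow_ne_zero 3 ha)
      linear_combination h₃ / 512

/-! ### The spectrum of the hermitian part -/

theorem det_tridiag (l : ℂ) (b c : Fin 5 → ℂ) :
    (tridiag l b c).det = l ^ 6 - (b 0 * c 0 + b 1 * c 1 + b 2 * c 2 + b 3 * c 3 + b 4 * c 4) * l ^ 4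
      + (b 0 * c 0 * (b 2 * c 2) + b 0 * c 0 * (b 3 * c 3) + b 0 * c 0 * (b 4 * c 4)
        + b 1 * c 1 * (b 3 * c 3) + b 1 * c 1 * (b 4 * c 4) + b 2 * c 2 * (b 4 * c 4)) * l ^ 2
      - b 0 * c 0 * (b 2 * c 2) * (b 4 * c 4) := by
  have : tridiag l b c = !![l, b 0, 0, 0, 0, 0; c 0, l, b 1, 0, 0, 0; 0, c 1, l, b 2, 0, 0;
      0, 0, c 2, l, b 3, 0; 0, 0, 0, c 3, l, b 4; 0, 0, 0, 0, c 4, l] := by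
    ext i j
    fin_cases i <;> fin_cases j <;> simp [tridiag]
  rw [this]
  simp [Matrix.det_succ_row_zero, Fin.sum_univ_succ, Fin.succAbove, Matrix.submatrix]
  ring

theorem rePart_smul_tridiag {m : ℕ} (n : ℂ) (b c : Fin m → ℂ) :
    rePart (n • tridiag 0 b c) = tridiag 0 (fun j => (n * b j + conj (n * c j)) / 2)
      (fun j => (n * c j + conj (n * b j)) / 2) := by
  ext i j
  simp only [rePart, tridiag, Matrix.smul_apply, Matrix.add_apply, Matrix.conjTranspose_apply,
    Matrix.of_apply, smul_eq_mul, starRingEnd_apply]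
  split_ifs <;> first | omega | (simp; done) | (simp; ring)

theorem algebraMap_sub_tridiag {m : ℕ} (l : ℂ) (b c : Fin m → ℂ) :
    algebraMap ℂ (Matrix (Fin (m + 1)) (Fin (m + 1)) ℂ) l - tridiag 0 b c
      = tridiag l (-b) (-c) := by
  ext i j
  simp only [tridiag, Matrix.sub_apply, Matrix.algebraMap_matrix_apply, Matrix.of_apply,
    Pi.neg_apply]
  split_ifs <;> simp

/-- The product of opposite off-diagonal entries of `Re(n A)`, for a unit `n = e^{iθ}`, is
`(A_j + cos 2θ) / 2`; this is where reciprocity enters. -/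
theorem offDiag_mul_offDiag {b c n : ℂ} (hbc : b * c = 1) (hn : ‖n‖ = 1) :
    (n * b + conj (n * c)) / 2 * ((n * c + conj (n * b)) / 2)
      = ((((‖b‖ ^ 2 + ‖c‖ ^ 2) / 2 + (n ^ 2).re) / 2 : ℝ) : ℂ) := by
  have hb : b * conj b = (‖b‖ : ℂ) ^ 2 := mul_conj' b
  have hc : c * conj c = (‖c‖ : ℂ) ^ 2 := mul_conj' c
  have hn' : n * conj n = 1 := by rw [mul_conj', hn]; norm_num
  have hbc' : conj b * conj c = 1 := by rw [← map_mul, hbc, map_one]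
  have hre : ((n ^ 2).re : ℂ) = (n ^ 2 + conj n ^ 2) / 2 := by
    rw [re_eq_add_conj, map_pow]
  push_cast
  rw [hre, ← hb, ← hc, map_mul, map_mul]
  linear_combination (n ^ 2 / 4) * hbc + (conj n ^ 2 / 4) * hbc'
    + (b * conj b + c * conj c) / 4 * hn'

theorem mem_spectrum_rePart_iff (b c : Fin 5 → ℂ) (hbc : ∀ j, b j * c j = 1) {n : ℂ}
    (hn : ‖n‖ = 1) (μ : ℝ) :
    (μ : ℂ) ∈ spectrum ℂ (rePart (n • tridiag 0 b c)) ↔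
      ngPoly (offDiagParam b c 0) (offDiagParam b c 1) (offDiagParam b c 2) (offDiagParam b c 3)
        (offDiagParam b c 4) (μ ^ 2) (n ^ 2).re = 0 := by
  rw [spectrum.mem_iff, Matrix.isUnit_iff_isUnit_det, isUnit_iff_ne_zero, not_not,
    rePart_smul_tridiag, algebraMap_sub_tridiag, det_tridiag]
  simp only [Pi.neg_apply, neg_mul_neg, offDiag_mul_offDiag (hbc _) hn]
  rw [← Complex.ofReal_eq_zero]
  simp only [offDiagParam, ngPoly]
  push_cast
  constructor <;> intro h <;> linear_combination h

/-! ### Lines and their normals -/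

theorem exists_eq_mul_I {z : ℂ} (h : z.re = 0) : ∃ k : ℝ, z = k * I :=
  ⟨z.im, Complex.ext (by simp [h]) (by simp)⟩

theorem realLine_eq {n p d : ℂ} (hn : n ≠ 0) (hd : d ≠ 0) (h : (n * d).re = 0) :
    realLine p d = {w | (n * w).re = (n * p).re} := by
  ext w
  constructor
  · rintro ⟨s, rfl⟩
    rw [Set.mem_ofPred_eq, show n * (p + s * d) = n * p + s * (n * d) by ring, add_re,
      re_ofReal_mul, h]
    ring
  · intro hw
    obtain ⟨k, hk⟩ := exists_eq_mul_I h
    obtain ⟨l, hl⟩ := exists_eq_mul_I (z := n * (w - p)) (by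
      rw [mul_sub, sub_re, hw, sub_self])
    have hk0 : (k : ℂ) ≠ 0 := by
      intro hk0
      rw [hk0, zero_mul] at hk
      exact mul_ne_zero hn hd hk
    refine ⟨l / k, mul_left_cancel₀ hn ?_⟩
    have : ((l / k : ℝ) : ℂ) * (k * I) = l * I := by
      push_cast
      field_simp
    linear_combination hl + (-(l / k : ℝ) : ℂ) * hk - this

theorem eq_or_eq_neg_of_normal {n n' d : ℂ} (hn : ‖n‖ = 1) (hn' : ‖n'‖ = 1) (hd : d ≠ 0)
    (h : (n * d).re = 0) (h' : (n' * d).re = 0) : n' = n ∨ n' = -n := by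
  obtain ⟨k, hk⟩ := exists_eq_mul_I h
  obtain ⟨l, hl⟩ := exists_eq_mul_I h'
  have hab : |l| = |k| := by
    have e₁ := congrArg norm hk
    have e₂ := congrArg norm hl
    simp only [norm_mul, hn, hn', norm_real, norm_I, mul_one, one_mul, Real.norm_eq_abs] at e₁ e₂
    rw [← e₁, ← e₂]
  rcases abs_eq_abs.1 hab with e | e
  · left
    apply mul_right_cancel₀ hd
    rw [hk, hl, e]
  · right
    apply mul_right_cancel₀ hd
    rw [neg_mul, hk, hl, e, ofReal_neg, neg_mul]

/-- A line belongs to the tangents of `C(A)` iff the NR generating polynomial vanishes at its squared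
distance from the origin; the unit normal may be either of the two. -/
theorem realLine_mem_kippenhahnTangents_iff (b c : Fin 5 → ℂ) (hbc : ∀ j, b j * c j = 1)
    {n p d : ℂ} (hn : ‖n‖ = 1) (hd : d ≠ 0) (h : (n * d).re = 0) :
    realLine p d ∈ kippenhahnTangents (tridiag 0 b c) ↔
      ngPoly (offDiagParam b c 0) (offDiagParam b c 1) (offDiagParam b c 2) (offDiagParam b c 3)
        (offDiagParam b c 4) ((n * p).re ^ 2) (n ^ 2).re = 0 := by
  have key : ∀ θ μ : ℝ, realLine (exp (-((θ : ℂ) * I)) * (μ : ℂ)) (exp (-((θ : ℂ) * I)) * I)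
      = {w | (exp ((θ : ℂ) * I) * w).re = μ} := by
    intro θ μ
    have he : exp ((θ : ℂ) * I) * exp (-((θ : ℂ) * I)) = 1 := by rw [← exp_add]; simp
    rw [realLine_eq (n := exp ((θ : ℂ) * I)) (exp_ne_zero _)
      (mul_ne_zero (exp_ne_zero _) I_ne_zero)]
    · rw [← mul_assoc, he, one_mul, ofReal_re]
    · rw [← mul_assoc, he, one_mul, I_re]
  have hn0 : n ≠ 0 := by
    rintro rfl
    simp at hn
  constructor
  · rintro ⟨θ, μ, hμ, hL⟩
    have hu : ‖exp ((θ : ℂ) * I)‖ = 1 := norm_exp_ofReal_mul_I θ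
    rw [mem_spectrum_rePart_iff b c hbc hu] at hμ
    rw [key] at hL
    have hp : (exp ((θ : ℂ) * I) * p).re = μ := by
      have : p ∈ realLine p d := ⟨0, by simp⟩
      rwa [hL] at this
    have hpd : (exp ((θ : ℂ) * I) * (p + d)).re = μ := by
      have : p + d ∈ realLine p d := ⟨1, by simp⟩
      rwa [hL] at this
    have hd' : (exp ((θ : ℂ) * I) * d).re = 0 := by
      rw [mul_add, add_re] at hpd
      linarith
    rw [← hp] at hμ
    rcases eq_or_eq_neg_of_normal hn hu hd h hd' with e | e <;> rw [e] at hμ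
    · exact hμ
    · rwa [neg_mul, neg_re, neg_sq, neg_sq] at hμ
  · intro hP
    have hθ : exp ((arg n : ℂ) * I) = n := by
      have := norm_mul_exp_arg_mul_I n
      rwa [hn, ofReal_one, one_mul] at this
    refine ⟨arg n, (n * p).re, ?_, ?_⟩
    · rw [hθ]
      exact (mem_spectrum_rePart_iff b c hbc hn _).2 hP
    · rw [key, hθ, realLine_eq hn0 hd h]

/-! ### Elliptical components satisfy the criterion -/

/-- A quadratic form in `(cos θ, sin θ)` whose values are roots of the NR generating polynomial for all
`θ` yields a root of the cubic satisfying the criterion. -/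
theorem exists_criterion_of_form {A₁ A₂ A₃ A₄ A₅ α β γ : ℝ}
    (h : ∀ X Y : ℝ, X ^ 2 + Y ^ 2 = 1 →
      ngPoly A₁ A₂ A₃ A₄ A₅ (α * X ^ 2 + β * (X * Y) + γ * Y ^ 2) (X ^ 2 - Y ^ 2) = 0) :
    ∃ x : ℝ, 8 * x ^ 3 - 20 * x ^ 2 + 12 * x - 1 = 0 ∧
      R1 A₁ A₂ A₃ A₄ A₅ x = 0 ∧ R2 A₁ A₂ A₃ A₄ A₅ x = 0 := by
  have key := ngPoly_form_root (A₁ := A₁) (A₂ := A₂) (A₃ := A₃) (A₄ := A₄) (A₅ := A₅)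
    -- Passage to the double angle: `n² = c + is`, with `X = re n` and `Y = im n`.
    (x := (α - γ) / 2) (y := β / 2) (z := (α + γ) / 2) (by
      intro c s hcs
      obtain ⟨n, hn⟩ := IsAlgClosed.exists_pow_nat_eq (⟨c, s⟩ : ℂ) (n := 2) (by norm_num)
      have hc : n.re ^ 2 - n.im ^ 2 = c := by
        have := congrArg re hn
        simp only [pow_two, mul_re] at this
        linear_combination this
      have hs : 2 * (n.re * n.im) = s := by
        have := congrArg im hn
        simp only [pow_two, mul_im] at this
        linear_combination this
      have h1 : n.re ^ 2 + n.im ^ 2 = 1 := by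
        have : (n.re ^ 2 + n.im ^ 2) ^ 2 = 1 := by
          rw [← hcs, ← hc, ← hs]
          ring
        nlinarith [sq_nonneg n.re, sq_nonneg n.im]
      have := h n.re n.im h1
      rw [hc] at this
      convert this using 2
      rw [← hc, ← hs]
      linear_combination -(α + γ) / 2 * h1)
  exact ⟨_, key.1, (eval_eq_zero_iff_R key.1).1 ⟨_, key.2⟩⟩

/-- A continuous function on the unit circle that vanishes off a line through the origin vanishes
everywhere on the circle. -/
theorem eq_zero_of_eq_zero_off_line {G : ℝ → ℝ → ℝ} (hG : Continuous fun v : ℝ × ℝ => G v.1 v.2)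
    {p q : ℝ} (hpq : p ^ 2 + q ^ 2 ≠ 0)
    (h : ∀ X Y : ℝ, X ^ 2 + Y ^ 2 = 1 → p * X - q * Y ≠ 0 → G X Y = 0) {X Y : ℝ}
    (hXY : X ^ 2 + Y ^ 2 = 1) : G X Y = 0 := by
  by_cases hl : p * X - q * Y = 0
  swap
  · exact h X Y hXY hl
  -- Rotations of the point by angles in `(0, π)` leave the line, and continuity applies at `0`.
  have hk : p * Y + q * X ≠ 0 := by
    intro hk
    apply hpq
    linear_combination (p * X - q * Y) * hl + (p * Y + q * X) * hk - (p ^ 2 + q ^ 2) * hXY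
  have hcont : Continuous fun φ : ℝ =>
      G (X * Real.cos φ - Y * Real.sin φ) (X * Real.sin φ + Y * Real.cos φ) :=
    hG.comp (f := fun φ : ℝ => (X * Real.cos φ - Y * Real.sin φ, X * Real.sin φ + Y * Real.cos φ))
      (by fun_prop)
  have hsub : Set.Ioo 0 Real.pi ⊆ {φ : ℝ |
      G (X * Real.cos φ - Y * Real.sin φ) (X * Real.sin φ + Y * Real.cos φ) = 0} := by
    intro φ hφ
    refine h _ _ ?_ ?_
    · linear_combination (Real.sin φ ^ 2 + Real.cos φ ^ 2) * hXY + Real.sin_sq_add_cos_sq φ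
    · rw [show p * (X * Real.cos φ - Y * Real.sin φ) - q * (X * Real.sin φ + Y * Real.cos φ)
        = -(Real.sin φ * (p * Y + q * X)) by linear_combination Real.cos φ * hl]
      exact neg_ne_zero.2 (mul_ne_zero (Real.sin_pos_of_mem_Ioo hφ).ne' hk)
  have hcl := closure_minimal hsub (isClosed_singleton.preimage hcont)
  rw [closure_Ioo Real.pi_pos.ne] at hcl
  simpa using hcl ⟨le_rfl, Real.pi_pos.le⟩

theorem ellipseVelocity_ne_zero {u : ℂ} {r₁ r₂ : ℝ} (hu : u ≠ 0) (h₁ : r₁ ≠ 0) (h₂ : r₂ ≠ 0)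
    (t : ℝ) : ellipseVelocity u r₁ r₂ t ≠ 0 := by
  refine mul_ne_zero hu fun h0 => ?_
  have e₁ : r₁ * Real.sin t = 0 := by simpa [-ofReal_sin, -ofReal_cos] using congrArg re h0
  have e₂ : r₂ * Real.cos t = 0 := by simpa [-ofReal_sin, -ofReal_cos] using congrArg im h0
  have := Real.sin_sq_add_cos_sq t
  rw [(mul_eq_zero.1 e₁).resolve_left h₁, (mul_eq_zero.1 e₂).resolve_left h₂] at this
  norm_num at this

/-- The tangent of the ellipse with outward unit normal `conj n` is at signed distance `Re(n m) + g` from the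
origin, where `g` is the support function of the centered ellipse. -/
theorem ngPoly_of_ellipse (b c : Fin 5 → ℂ) (hbc : ∀ j, b j * c j = 1) {m u : ℂ} {r₁ r₂ : ℝ}
    (hu : ‖u‖ = 1) (h₁ : 0 < r₁) (h₂ : 0 < r₂)
    (h : ellipseTangents m u r₁ r₂ ⊆ kippenhahnTangents (tridiag 0 b c)) {n : ℂ} (hn : ‖n‖ = 1)
    {g : ℝ} (hg0 : 0 < g) (hg : g ^ 2 = r₁ ^ 2 * (n * u).re ^ 2 + r₂ ^ 2 * (n * u).im ^ 2) :
    ngPoly (offDiagParam b c 0) (offDiagParam b c 1) (offDiagParam b c 2) (offDiagParam b c 3)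
      (offDiagParam b c 4) (((n * m).re + g) ^ 2) (n ^ 2).re = 0 := by
  -- The point of contact of the tangent with the given normal.
  obtain ⟨t, ht⟩ : ∃ t : ℝ, exp (t * I) =
      ⟨r₁ * (n * u).re / g, -(r₂ * (n * u).im / g)⟩ := by
    rw [← norm_eq_one_iff]
    rw [← sq_eq_sq₀ (norm_nonneg _) zero_le_one, ← normSq_eq_norm_sq, normSq_mk]
    field_simp
    linear_combination -hg
  have hc : Real.cos t = r₁ * (n * u).re / g := by
    have := congrArg re ht
    rwa [exp_ofReal_mul_I_re] at this
  have hs : Real.sin t = -(r₂ * (n * u).im / g) := by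
    have := congrArg im ht
    rwa [exp_ofReal_mul_I_im] at this
  have hv := ellipseVelocity_ne_zero (norm_ne_zero_iff.1 (hu ▸ one_ne_zero)) h₁.ne' h₂.ne' t
  have hL := h ⟨t, rfl⟩
  rw [realLine_mem_kippenhahnTangents_iff b c hbc hn hv] at hL
  · convert hL using 2
    congr 1
    rw [ellipsePoint, mul_add, add_re, ← mul_assoc n u, hc, hs]
    generalize n * u = w at *
    simp
    field_simp
    linear_combination hg
  · rw [ellipseVelocity, ← mul_assoc n u, hc, hs]
    simp
    field_simp
    ring

/-- For a centered ellipse the squared support function is itself a quadratic form in `(cos θ, sin θ)`.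
Otherwise the two tangents with a given normal direction have squared distances `(l ± g)²`, and the
remaining root `(A₁ + ⋯ + A₅ + 5τ) / 2 - 2l² - 2g²` is such a form. -/
theorem exists_criterion_of_ellipse (b c : Fin 5 → ℂ) (hbc : ∀ j, b j * c j = 1)
    (h : HasEllipseComponent (tridiag 0 b c)) :
    ∃ x : ℝ, 8 * x ^ 3 - 20 * x ^ 2 + 12 * x - 1 = 0 ∧
      R1 (offDiagParam b c 0) (offDiagParam b c 1) (offDiagParam b c 2) (offDiagParam b c 3)
        (offDiagParam b c 4) x = 0 ∧
      R2 (offDiagParam b c 0) (offDiagParam b c 1) (offDiagParam b c 2) (offDiagParam b c 3)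
        (offDiagParam b c 4) x = 0 := by
  obtain ⟨m, u, r₁, r₂, hu, h₂, h₂₁, hsub⟩ := h
  have h₁ : 0 < r₁ := h₂.trans_le h₂₁
  have key : ∀ X Y : ℝ, X ^ 2 + Y ^ 2 = 1 → ∃ g : ℝ, 0 < g ∧
      g ^ 2 = r₁ ^ 2 * (X * u.re - Y * u.im) ^ 2 + r₂ ^ 2 * (X * u.im + Y * u.re) ^ 2 ∧
      ∀ ε : ℝ, ε = 1 ∨ ε = -1 → ngPoly (offDiagParam b c 0) (offDiagParam b c 1)
        (offDiagParam b c 2) (offDiagParam b c 3) (offDiagParam b c 4)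
        ((X * m.re - Y * m.im + ε * g) ^ 2) (X ^ 2 - Y ^ 2) = 0 := by
    intro X Y hXY
    have hn : ‖(⟨X, Y⟩ : ℂ)‖ = 1 := by
      rw [← sq_eq_sq₀ (norm_nonneg _) zero_le_one, ← normSq_eq_norm_sq, normSq_mk]
      linear_combination hXY
    have hw : (X * u.re - Y * u.im) ^ 2 + (X * u.im + Y * u.re) ^ 2 = 1 := by
      have hu' : u.re * u.re + u.im * u.im = 1 := by
        rw [← normSq_apply, normSq_eq_norm_sq, hu, one_pow]
      linear_combination (u.re ^ 2 + u.im ^ 2) * hXY + hu'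
    have hpos : 0 < r₁ ^ 2 * (X * u.re - Y * u.im) ^ 2 + r₂ ^ 2 * (X * u.im + Y * u.re) ^ 2 := by
      have : r₂ ^ 2 ≤ r₁ ^ 2 := pow_le_pow_left₀ h₂.le h₂₁ 2
      nlinarith [sq_nonneg (X * u.re - Y * u.im), pow_pos h₂ 2]
    refine ⟨_, Real.sqrt_pos.2 hpos, Real.sq_sqrt hpos.le, ?_⟩
    have hg := Real.sq_sqrt hpos.le
    have hg0 := Real.sqrt_pos.2 hpos
    generalize √(r₁ ^ 2 * (X * u.re - Y * u.im) ^ 2 + r₂ ^ 2 * (X * u.im + Y * u.re) ^ 2) = g at *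
    rintro ε (rfl | rfl)
    · convert ngPoly_of_ellipse b c hbc hu h₁ h₂ hsub hn hg0 (by simpa using hg) using 2
      · simp
      · simp [pow_two]
    -- The opposite tangent has normal `-n`, and `(l - g)² = (-l + g)²`.
    · convert ngPoly_of_ellipse b c hbc hu h₁ h₂ hsub (n := -⟨X, Y⟩) (by rwa [norm_neg]) hg0
        (by
          rw [neg_mul, neg_re, neg_im, neg_sq, neg_sq]
          simpa using hg) using 2
      · simp
        ring
      · simp [pow_two]
  generalize offDiagParam b c 0 = A₁ at *
  generalize offDiagParam b c 1 = A₂ at *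
  generalize offDiagParam b c 2 = A₃ at *
  generalize offDiagParam b c 3 = A₄ at *
  generalize offDiagParam b c 4 = A₅ at *
  by_cases hm : m = 0
  · subst hm
    refine exists_criterion_of_form (α := r₁ ^ 2 * u.re ^ 2 + r₂ ^ 2 * u.im ^ 2)
      (β := 2 * u.re * u.im * (r₂ ^ 2 - r₁ ^ 2))
      (γ := r₁ ^ 2 * u.im ^ 2 + r₂ ^ 2 * u.re ^ 2) fun X Y hXY => ?_
    obtain ⟨g, -, hg, hP⟩ := key X Y hXY
    convert hP 1 (Or.inl rfl) using 2
    simp only [zero_re, zero_im]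
    linear_combination -hg
  · obtain ⟨S, hS⟩ : ∃ S, S = A₁ + A₂ + A₃ + A₄ + A₅ := ⟨_, rfl⟩
    obtain ⟨α, hα⟩ : ∃ α, α =
      (S + 5) / 2 - 2 * m.re ^ 2 - 2 * (r₁ ^ 2 * u.re ^ 2 + r₂ ^ 2 * u.im ^ 2) := ⟨_, rfl⟩
    obtain ⟨β, hβ⟩ : ∃ β, β =
      4 * m.re * m.im - 4 * u.re * u.im * (r₂ ^ 2 - r₁ ^ 2) := ⟨_, rfl⟩
    obtain ⟨γ, hγ⟩ : ∃ γ, γ =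
      (S - 5) / 2 - 2 * m.im ^ 2 - 2 * (r₁ ^ 2 * u.im ^ 2 + r₂ ^ 2 * u.re ^ 2) := ⟨_, rfl⟩
    refine exists_criterion_of_form (α := α) (β := β) (γ := γ) fun X Y hXY => ?_
    refine eq_zero_of_eq_zero_off_line (G := fun X Y => ngPoly A₁ A₂ A₃ A₄ A₅
      (α * X ^ 2 + β * (X * Y) + γ * Y ^ 2) (X ^ 2 - Y ^ 2)) (p := m.re) (q := m.im)
      ?_ ?_ ?_ hXY
    · unfold ngPoly
      fun_prop
    · intro h0
      apply hm
      apply Complex.ext <;> simp only [zero_re, zero_im] <;>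
        nlinarith [sq_nonneg m.re, sq_nonneg m.im]
    · intro X Y hXY hl
      obtain ⟨g, hg0, hg, hP⟩ := key X Y hXY
      have := eq_zero_of_vieta (hP 1 (Or.inl rfl)) (hP (-1) (Or.inr rfl)) (by
        intro h0
        apply mul_ne_zero hl hg0.ne'
        linear_combination h0 / 4)
      convert this using 2
      rw [← hS, hα, hβ, hγ]
      linear_combination 2 * hg + S / 2 * hXY

/-- The lines through a single focus `p` suffice: `Re(n p)²` is a quadratic form in the normal `n`. -/
theorem exists_criterion_of_doubleton (b c : Fin 5 → ℂ) (hbc : ∀ j, b j * c j = 1)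
    (h : HasDoubletonComponent (tridiag 0 b c)) :
    ∃ x : ℝ, 8 * x ^ 3 - 20 * x ^ 2 + 12 * x - 1 = 0 ∧
      R1 (offDiagParam b c 0) (offDiagParam b c 1) (offDiagParam b c 2) (offDiagParam b c 3)
        (offDiagParam b c 4) x = 0 ∧
      R2 (offDiagParam b c 0) (offDiagParam b c 1) (offDiagParam b c 2) (offDiagParam b c 3)
        (offDiagParam b c 4) x = 0 := by
  obtain ⟨p, q, -, hsub⟩ := h
  refine exists_criterion_of_form (α := p.re ^ 2) (β := -2 * p.re * p.im) (γ := p.im ^ 2)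
    fun X Y hXY => ?_
  have hn : ‖(⟨X, Y⟩ : ℂ)‖ = 1 := by
    rw [← sq_eq_sq₀ (norm_nonneg _) zero_le_one, ← normSq_eq_norm_sq, normSq_mk]
    linear_combination hXY
  have hd : (⟨Y, X⟩ : ℂ) ≠ 0 := by
    intro h0
    have e₁ : Y = 0 := congrArg re h0
    have e₂ : X = 0 := congrArg im h0
    simp [e₁, e₂] at hXY
  have hL := hsub ⟨_, hd, Or.inl rfl⟩
  rw [realLine_mem_kippenhahnTangents_iff b c hbc hn hd (by simp; ring)] at hL
  convert hL using 2
  · simp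
    ring
  · simp [pow_two]

/-! ### Construction of elliptical components -/

theorem one_le_offDiagParam {m : ℕ} {b c : Fin m → ℂ} (hbc : ∀ j, b j * c j = 1) (j : Fin m) :
    1 ≤ offDiagParam b c j := by
  have h : ‖b j‖ * ‖c j‖ = 1 := by rw [← norm_mul, hbc, norm_one]
  unfold offDiagParam
  nlinarith [sq_nonneg (‖b j‖ - ‖c j‖)]

/-- The centered ellipse with half-axes `√(z + x)` and `√(z - x)` along the coordinate axes has
squared support function `x cos 2θ + z`. -/
theorem ellipse_component (b c : Fin 5 → ℂ) (hbc : ∀ j, b j * c j = 1) {x z : ℝ} (hx : 0 < x)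
    (hxz : x < z) (h : ∀ τ, ngPoly (offDiagParam b c 0) (offDiagParam b c 1) (offDiagParam b c 2)
      (offDiagParam b c 3) (offDiagParam b c 4) (x * τ + z) τ = 0) :
    HasEllipseComponent (tridiag 0 b c) := by
  obtain ⟨r₁, h₁, hr₁⟩ : ∃ r : ℝ, 0 < r ∧ r ^ 2 = z + x :=
    ⟨√(z + x), Real.sqrt_pos.2 (by linarith), Real.sq_sqrt (by linarith)⟩
  obtain ⟨r₂, h₂, hr₂⟩ : ∃ r : ℝ, 0 < r ∧ r ^ 2 = z - x :=
    ⟨√(z - x), Real.sqrt_pos.2 (by linarith), Real.sq_sqrt (by linarith)⟩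
  refine ⟨0, 1, r₁, r₂, norm_one, h₂, ?_, ?_⟩
  · apply le_of_sq_le_sq _ h₁.le
    linarith
  rintro L ⟨t, rfl⟩
  have hcs := Real.sin_sq_add_cos_sq t
  have hpos : 0 < (r₁ * Real.sin t) ^ 2 + (r₂ * Real.cos t) ^ 2 := by
    rw [mul_pow, mul_pow, hr₁, hr₂]
    nlinarith [sq_nonneg (Real.sin t)]
  obtain ⟨g, hg0, hg⟩ : ∃ g : ℝ, 0 < g ∧ g ^ 2 = (r₁ * Real.sin t) ^ 2 + (r₂ * Real.cos t) ^ 2 :=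
    ⟨_, Real.sqrt_pos.2 hpos, Real.sq_sqrt hpos.le⟩
  have hn : ‖(⟨r₂ * Real.cos t / g, -(r₁ * Real.sin t / g)⟩ : ℂ)‖ = 1 := by
    rw [← sq_eq_sq₀ (norm_nonneg _) zero_le_one, ← normSq_eq_norm_sq, normSq_mk]
    field_simp
    linear_combination -hg
  have hv := ellipseVelocity_ne_zero one_ne_zero h₁.ne' h₂.ne' t
  rw [realLine_mem_kippenhahnTangents_iff b c hbc hn hv]
  · rw [← h]
    congr 1
    simp only [ellipsePoint, one_mul, zero_add, add_re, add_im, mul_re, mul_im, ofReal_re,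
      ofReal_im, I_re, I_im, pow_two]
    obtain rfl : x = (r₁ ^ 2 - r₂ ^ 2) / 2 := by linarith
    obtain rfl : z = (r₁ ^ 2 + r₂ ^ 2) / 2 := by linarith
    field_simp
    linear_combination 2 * r₁ ^ 2 * r₂ ^ 2 * (Real.sin t ^ 2 + Real.cos t ^ 2) * hcs
      - (r₁ ^ 2 + r₂ ^ 2) * hg
  · simp only [ellipseVelocity, one_mul, add_re, add_im, mul_re, mul_im, ofReal_re,
      ofReal_im, I_re, I_im]
    field_simp
    ring

/-- The case `z = x` of `ellipse_component`, where the foci are `±√(2x)`. -/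
theorem doubleton_component (b c : Fin 5 → ℂ) (hbc : ∀ j, b j * c j = 1) {x : ℝ} (hx : 0 < x)
    (h : ∀ τ, ngPoly (offDiagParam b c 0) (offDiagParam b c 1) (offDiagParam b c 2)
      (offDiagParam b c 3) (offDiagParam b c 4) (x * τ + x) τ = 0) :
    HasDoubletonComponent (tridiag 0 b c) := by
  obtain ⟨r, hr0, hr⟩ : ∃ r : ℝ, 0 < r ∧ r ^ 2 = 2 * x :=
    ⟨√(2 * x), Real.sqrt_pos.2 (by linarith), Real.sq_sqrt (by linarith)⟩
  have key : ∀ ε : ℝ, ε ^ 2 = r ^ 2 → ∀ d : ℂ, d ≠ 0 →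
      realLine ε d ∈ kippenhahnTangents (tridiag 0 b c) := by
    intro ε hε d hd
    have hd' : (‖d‖ : ℂ) ≠ 0 := by simpa using hd
    have hn : ‖I * conj d / ‖d‖‖ = 1 := by simp [hd]
    have hn' : (I * conj d / ‖d‖).re ^ 2 + (I * conj d / ‖d‖).im ^ 2 = 1 := by
      rw [pow_two, pow_two, ← normSq_apply, normSq_eq_norm_sq, hn, one_pow]
    rw [realLine_mem_kippenhahnTangents_iff b c hbc hn hd]
    · rw [← h]
      congr 1
      generalize I * conj d / ‖d‖ = n at *
      rw [re_mul_ofReal, pow_two n, mul_re, mul_pow, hε, hr]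
      linear_combination x * hn'
    · rw [div_mul_eq_mul_div, mul_assoc, mul_comm (conj d), mul_conj', pow_two, ← mul_assoc,
        mul_div_assoc, div_self hd', mul_one]
      simp
  refine ⟨r, (-r : ℝ), ?_, ?_⟩
  · intro h0
    have : r = -r := by exact_mod_cast h0
    linarith
  · rintro L ⟨d, hd, rfl | rfl⟩
    · exact key _ rfl d hd
    · exact key _ (by ring) d hd

end Kippenhahn

end

open Kippenhahn in
theorem theorem4p1 (b c : Fin 5 → ℂ) (hbc : ∀ j, b j * c j = 1)
    (A : Matrix (Fin 6) (Fin 6) ℂ) (hA : A = tridiag 0 b c)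
    (A₁ A₂ A₃ A₄ A₅ : ℝ)
    (h₁ : A₁ = offDiagParam b c 0) (h₂ : A₂ = offDiagParam b c 1)
    (h₃ : A₃ = offDiagParam b c 2) (h₄ : A₄ = offDiagParam b c 3)
    (h₅ : A₅ = offDiagParam b c 4) :
    -- the criterion
    (HasEllipticalComponent A ↔
      ∃ x : ℝ, 8 * x ^ 3 - 20 * x ^ 2 + 12 * x - 1 = 0 ∧
        R1 A₁ A₂ A₃ A₄ A₅ x = 0 ∧ R2 A₁ A₂ A₃ A₄ A₅ x = 0) ∧
    -- the same criterion for non-degenerate ellipses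
    (1 < A₁ → 1 < A₃ → 1 < A₅ →
      (HasEllipseComponent A ↔
        ∃ x : ℝ, 8 * x ^ 3 - 20 * x ^ 2 + 12 * x - 1 = 0 ∧
          R1 A₁ A₂ A₃ A₄ A₅ x = 0 ∧ R2 A₁ A₂ A₃ A₄ A₅ x = 0)) ∧
    -- at the roots of the cubic, `R₁` and `R₂` are the resultants, up to numerical factors
    (∀ x : ℝ, 8 * x ^ 3 - 20 * x ^ 2 + 12 * x - 1 = 0 →
      R1 A₁ A₂ A₃ A₄ A₅ x =
          128 * Polynomial.resultant (Q1 A₁ A₂ A₃ A₄ A₅ x) (Q2 A₁ A₂ A₃ A₄ A₅ x) 1 2 ∧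
      R2 A₁ A₂ A₃ A₄ A₅ x =
          512 * Polynomial.resultant (Q1 A₁ A₂ A₃ A₄ A₅ x) (Q3 A₁ A₂ A₃ A₄ A₅) 1 3) := by
  subst hA
  have suff : ∀ x : ℝ, 8 * x ^ 3 - 20 * x ^ 2 + 12 * x - 1 = 0 →
      R1 A₁ A₂ A₃ A₄ A₅ x = 0 → R2 A₁ A₂ A₃ A₄ A₅ x = 0 → 0 < x ∧ ∃ z, x ≤ z ∧
        ∀ τ, ngPoly A₁ A₂ A₃ A₄ A₅ (x * τ + z) τ = 0 := by
    intro x hx hR1 hR2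
    obtain ⟨z, hz₁, hz₂, hz₃⟩ := (eval_eq_zero_iff_R hx).2 ⟨hR1, hR2⟩
    have hP : ∀ τ, ngPoly A₁ A₂ A₃ A₄ A₅ (x * τ + z) τ = 0 := by
      intro τ
      rw [ngPoly_linear, hx, hz₁, hz₂, hz₃]
      ring
    refine ⟨cubic_root_pos hx, z, ?_, hP⟩
    -- At `τ = -1` all products of off-diagonal entries are nonnegative, so no root is negative.
    by_contra! hlt
    have hA := one_le_offDiagParam hbc
    refine (ngPoly_neg (A₁ := A₁) (A₂ := A₂) (A₃ := A₃) (A₄ := A₄) (A₅ := A₅)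
      (ζ := x * -1 + z) (τ := -1) ?_ ?_ ?_ ?_ ?_ (by linarith)).ne (hP (-1))
    · linarith [hA 0]
    · linarith [hA 1]
    · linarith [hA 2]
    · linarith [hA 3]
    · linarith [hA 4]
  refine ⟨⟨?_, ?_⟩, fun g₁ g₃ g₅ => ⟨?_, ?_⟩, fun x hx =>
    ⟨R1_eq_resultant _ _ _ _ _ hx, R2_eq_resultant _ _ _ _ _ hx⟩⟩
  · subst h₁ h₂ h₃ h₄ h₅
    rintro (h | h)
    · exact exists_criterion_of_ellipse b c hbc h
    · exact exists_criterion_of_doubleton b c hbc h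
  · rintro ⟨x, hx, hR1, hR2⟩
    obtain ⟨hx0, z, hxz, hP⟩ := suff x hx hR1 hR2
    subst h₁ h₂ h₃ h₄ h₅
    rcases hxz.lt_or_eq with hlt | rfl
    · exact Or.inl (ellipse_component b c hbc hx0 hlt hP)
    · exact Or.inr (doubleton_component b c hbc hx0 hP)
  · subst h₁ h₂ h₃ h₄ h₅
    exact exists_criterion_of_ellipse b c hbc
  · rintro ⟨x, hx, hR1, hR2⟩
    obtain ⟨hx0, z, hxz, hP⟩ := suff x hx hR1 hR2
    have hlt : x < z := by
      refine lt_of_le_of_ne hxz ?_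
      rintro rfl
      -- For `z = x` the value `ζ = 0` is a root at `τ = -1`, so `(A₁ - 1)(A₃ - 1)(A₅ - 1) = 0`.
      have h0 := hP (-1)
      have hprod : 0 < (A₁ + -1) * (A₃ + -1) * (A₅ + -1) :=
        mul_pos (mul_pos (by linarith) (by linarith)) (by linarith)
      unfold ngPoly at h0
      rw [show x * -1 + x = 0 by ring] at h0
      linarith
    subst h₁ h₂ h₃ h₄ h₅
    exact ellipse_component b c hbc hx0 hlt hP
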